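/- For a regular language $L$ over a finite alphabet, let $\mathrm{sc}(L)$ be the number of states of its minimal complete DFA. For a ternary operation $\otimes$ on languages, let $\mathrm{sc}_{\otimes}(m,n,p)$ be the maximum of $\mathrm{sc}(\otimes(A,B,C))$ over all regular languages $A,B,C$ over a common finite alphabet (of any size) with $\mathrm{sc}(A)=m$, $\mathrm{sc}(B)=n$, $\mathrm{sc}(C)=p$. For $n\ge 2$, pairwise distinct letters $\sigma_1,\sigma_2,\sigma_3$ of the alphabet $\Sigma$, any of which may be missing (written $-$), and $\Gamma=\Sigma\setminus\{\sigma_1,\sigma_2,\sigma_3\}$, let $\mathcal X_n(\sigma_1,\sigma_2,\sigma_3;\Gamma)$ be the language of the DFA over $\Sigma$ with states $0,\dots,n-1$, initial state $0$ and unique final state $n-1$, in which $\sigma_1$ acts as the cycle $(0,1,\dots,n-1)$, $\sigma_2$ as the transposition $(0,1)$, $\sigma_3$ as the map that sends $1$ to $0$ and fixes every other state, and every letter of $\Gamma$ as the identity. **Theorem.** Let $m,n,p\ge 3$. Then $$\mathrm{sc}_{\star\cdot(\star\cap\star)}(m,n,p)=(m-1)2^{np}+2^{np-1},$$ $$\mathrm{sc}_{\star\cdot(\star\cup\star)}(m,n,p)=(m-1)\bigl(2^{n+p}-2^n-2^p+2\bigr)+2^{n+p-2}.$$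 In both cases the maximum is attained by the same triple of languages over the three-letter alphabet $\{a,b,c\}$, $$\bigl(\mathcal X_m(a,b,-;\{c\}),\ \mathcal X_n(b,a,c;\emptyset),\ \mathcal X_p(b,-,c;\{a\})\bigr),$$ whose members have state complexities $m$, $n$ and $p$ respectively. -/

import Mathlib

/-- The state complexity of a language `L`: the least number of states of a complete deterministic
finite automaton that recognizes `L` (and `0` if there is none, that is if `L` is not regular). -/
noncomputable def stateComplexity {α : Type} (L : Language α) : ℕ :=
  sInf {k : ℕ | ∃ M : DFA α (Fin k), M.accepts = L}

/-- The class `𝓛ₙ` of the regular languages over `α` of state complexity `n`. -/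
def languagesOfComplexity (α : Type) (n : ℕ) : Set (Language α) :=
  {L | L.IsRegular ∧ stateComplexity L = n}

/-- `op` is a ternary operation on languages, given over every alphabet. `N` is its state complexity
at `(n₁, n₂, n₃)` if it is the maximum of the state complexities of `op L₁ L₂ L₃`, where `L₁`, `L₂`
and `L₃` are regular languages of state complexities `n₁`, `n₂` and `n₃` over a common finite
alphabet. -/
def IsOperationStateComplexity
    (op : ∀ {α : Type}, Language α → Language α → Language α → Language α)
    (n₁ n₂ n₃ N : ℕ) : Prop :=
  IsGreatest
    {k : ℕ | ∃ (α : Type) (_ : Finite α) (L₁ L₂ L₃ : Language α),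
      L₁ ∈ languagesOfComplexity α n₁ ∧ L₂ ∈ languagesOfComplexity α n₂ ∧
      L₃ ∈ languagesOfComplexity α n₃ ∧ stateComplexity (op L₁ L₂ L₃) = k} N

/-- The operation `L₁ · (L₂ ∩ L₃)`. -/
def catInter {α : Type} (L₁ L₂ L₃ : Language α) : Language α := L₁ * (L₂ ⊓ L₃)

/-- The operation `L₁ · (L₂ ∪ L₃)`. -/
def catUnion {α : Type} (L₁ L₂ L₃ : Language α) : Language α := L₁ * (L₂ ⊔ L₃)

/-- The Brzozowski automaton `𝒳ₙ(σ₁, σ₂, σ₃; …)` over the alphabet `α`, with states `0, …, n - 1`,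
initial state `0` and final state `n - 1`. The letter `σ₁` acts as the cycle `(0, …, n - 1)`, `σ₂` as
the transposition `(0, 1)`, `σ₃` as the contraction sending `1` to `0`, and every other letter as the
identity. The absence `-` of a letter is `none`. -/
def brzozowski {α : Type} [DecidableEq α] (n : ℕ) (hn : 2 ≤ n) (σ₁ σ₂ σ₃ : Option α) :
    DFA α (Fin n) where
  step q s :=
    if some s = σ₁ then ⟨(q.val + 1) % n, Nat.mod_lt _ (by omega)⟩
    else if some s = σ₂ then Equiv.swap (⟨0, by omega⟩ : Fin n) ⟨1, by omega⟩ q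
    else if some s = σ₃ then (if q.val = 1 then ⟨0, by omega⟩ else q)
    else q
  start := ⟨0, by omega⟩
  accept := {⟨n - 1, by omega⟩}

/-- The three-letter alphabet `{a, b, c}`. -/
inductive Letter
  | a
  | b
  | c
  deriving DecidableEq

/-- `𝒳ₘ(a, b, -; {c})`. -/
def witnessA (m : ℕ) (hm : 2 ≤ m) : Language Letter :=
  (brzozowski m hm (some Letter.a) (some Letter.b) none).accepts

/-- `𝒳ₙ(b, a, c; ∅)`. -/
def witnessB (n : ℕ) (hn : 2 ≤ n) : Language Letter :=
  (brzozowski n hn (some Letter.b) (some Letter.a) (some Letter.c)).accepts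

/-- `𝒳ₚ(b, -, c; {a})`. -/
def witnessC (p : ℕ) (hp : 2 ≤ p) : Language Letter :=
  (brzozowski p hp (some Letter.b) none (some Letter.c)).accepts

/-!
The state complexities of `L₁ · (L₂ ∩ L₃)` and `L₁ · (L₂ ∪ L₃)`.

Both operations are concatenations `L(A) · K`, where `K` is given by letters that act on a finite
set `X`, with initial points `I` and final points `F`: for an intersection `X` is the product of
the state sets of `B` and `C`, for a union it is their disjoint union, with two initial points.
The states of the subset automaton `concatDFA` are pairs `(q, S)` of a state of `A` and a subset
of `X`, and `I` is added to `S` whenever `A` enters a final state. So if `f` is a final state of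
`A`, every reachable pair satisfies `q = f → I ⊆ S`, and in the case of a union `S` meets both
parts of `X` or none of them. Counting these *valid* pairs gives the upper bounds.

For the witnesses, every valid pair is reachable and no two of them are equivalent. The main tool
is the set of the *loop words*, the products of `ab` and `bb`. They lead `A` from `0` back to `0`
without entering its final state, hence without adding any points, they permute `X`, and they act
transitively on the pairs of a state of `B` and a state of `C` (`exists_isLoopWord_evalFrom`).

Reachability (`exists_concatDFA_eval_eq`) is an induction on the size of `S`: as `a` and `b`
permute `X`, a nonempty set can be traced back, by a loop word and the letter `a`, to one over the
final state that contains `I`, from which a point of `I` can be removed.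

For distinguishability, let a point be in `S` and not in `S'`. Powers of `b` carry the difference
to a point of index at least `2`, which is fixed by `a`, and then powers of `a` lead the second
pair to the state `0` of `A`. From there a loop word leads the point to a final one. In the case
of a union a point of the other part has to be kept from becoming final at the same time, which is
what the letter `c` is for: it empties the points of index `1`. Finally, pairs with the same set
and different states of `A` are led by powers of `ca` to pairs with different sets
(`injOn_acceptsFrom_validStates`).
-/

open Finset

/-! ### State complexity and invariant sets of states -/

theorem DFA.acceptsFrom_step_congr {α σ : Type*} (M : DFA α σ) {s t : σ}
    (h : M.acceptsFrom s = M.acceptsFrom t) (l : α) :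
    M.acceptsFrom (M.step s l) = M.acceptsFrom (M.step t l) := by
  ext w
  have := congrArg (fun L : Language α => l :: w ∈ L) h
  simpa [DFA.mem_acceptsFrom] using this

/-- Restricting an automaton to a finite set of states that contains the initial state and is
closed under the transitions yields an equivalent automaton. -/
theorem exists_dfa_fin_card {α σ : Type} (M : DFA α σ) (V : Finset σ) (hs : M.start ∈ V)
    (hV : ∀ q ∈ V, ∀ l, M.step q l ∈ V) : ∃ N : DFA α (Fin #V), N.accepts = M.accepts := by
  let N : DFA α V :=
    { step := fun q l => ⟨M.step q l, hV q q.2 l⟩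
      start := ⟨M.start, hs⟩
      accept := {q | (q : σ) ∈ M.accept} }
  refine ⟨N.reindex V.equivFin, ?_⟩
  rw [DFA.accepts_reindex]
  have h : ∀ w : List α, ∀ q : V, ((N.evalFrom q w : V) : σ) = M.evalFrom q w := by
    intro w
    induction w with
    | nil => intro q; rfl
    | cons l w ih => intro q; exact ih _
  ext w
  rw [DFA.mem_accepts, DFA.mem_accepts, DFA.eval, DFA.eval, ← h w ⟨M.start, hs⟩]
  rfl

theorem stateComplexity_le_of_dfa {α : Type} {L : Language α} {k : ℕ} (N : DFA α (Fin k))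
    (h : N.accepts = L) : stateComplexity L ≤ k :=
  Nat.sInf_le ⟨N, h⟩

/-- An automaton attaining a positive state complexity. -/
theorem exists_dfa_of_stateComplexity {α : Type} {L : Language α} {k : ℕ} (hk : k ≠ 0)
    (h : stateComplexity L = k) : ∃ M : DFA α (Fin k), M.accepts = L := by
  have hne : {k : ℕ | ∃ M : DFA α (Fin k), M.accepts = L}.Nonempty := by
    refine Nat.nonempty_of_sInf_eq_succ (k := k - 1) ?_
    have : sInf {k : ℕ | ∃ M : DFA α (Fin k), M.accepts = L} = k := h
    omega
  have := Nat.sInf_mem hne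
  rw [← h]
  exact this

theorem stateComplexity_accepts_le {α σ : Type} (M : DFA α σ) (V : Finset σ) (hs : M.start ∈ V)
    (hV : ∀ q ∈ V, ∀ l, M.step q l ∈ V) : stateComplexity M.accepts ≤ #V := by
  obtain ⟨N, hN⟩ := exists_dfa_fin_card M V hs hV
  exact stateComplexity_le_of_dfa N hN

/-- The Myhill–Nerode criterion: a closed set of states that are reachable and pairwise
distinguishable counts the states of the minimal automaton. -/
theorem stateComplexity_accepts_eq {α σ : Type} (M : DFA α σ) (V : Finset σ) (hs : M.start ∈ V)
    (hV : ∀ q ∈ V, ∀ l, M.step q l ∈ V) (hreach : ∀ q ∈ V, ∃ w, M.eval w = q)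
    (hdist : Set.InjOn M.acceptsFrom V) : stateComplexity M.accepts = #V := by
  refine le_antisymm (stateComplexity_accepts_le M V hs hV) ?_
  refine le_csInf ⟨_, exists_dfa_fin_card M V hs hV⟩ ?_
  rintro k ⟨N, hN⟩
  have hNM : ∀ w, N.acceptsFrom (N.eval w) = M.acceptsFrom (M.eval w) := by
    intro w
    ext v
    have := congrArg (fun L : Language α => w ++ v ∈ L) hN
    simpa [DFA.mem_accepts, DFA.mem_acceptsFrom, DFA.eval, DFA.evalFrom_of_append] using this
  choose! w hw using hreach
  have := Finset.card_le_card_of_injOn (s := V) (t := (univ : Finset (Fin k)))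
    (fun q => N.eval (w q)) (fun _ _ => by simp) (by
      intro q hq q' hq' h
      have h1 := hNM (w q)
      have h2 := hNM (w q')
      simp only at h
      rw [h, h2, hw q hq, hw q' hq'] at h1
      exact (hdist hq' hq h1).symm)
  simpa using this

/-! ### The subset automaton of a concatenation -/

/-- The subset automaton for `L₁ * L₂`, where `A` recognizes `L₁` and `L₂` is recognized by letting
the letters act on `X` through `δ` from any of the initial points `I` to any of the final points
`F`. A state is the current state of `A` with the set of the points of `X` reached so far; the set
`I` is added whenever `A` enters a final state. -/
noncomputable def concatDFA {α Q X : Type} [DecidableEq X] (A : DFA α Q) (δ : X → α → X)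
    (I F : Finset X) : DFA α (Q × Finset X) :=
  open Classical in
  { step := fun s l =>
      (A.step s.1 l, s.2.image (δ · l) ∪ if A.step s.1 l ∈ A.accept then I else ∅)
    start := (A.start, if A.start ∈ A.accept then I else ∅)
    accept := {s | ∃ x ∈ s.2, x ∈ F} }

/-- The language of the words that lead from some point of `I` to some point of `F`. -/
def actionLanguage {α X : Type} (δ : X → α → X) (I F : Finset X) : Language α :=
  {w | ∃ x ∈ I, w.foldl δ x ∈ F}

/-- The pairs `(q, S)` such that `S` satisfies `ok`, and contains `I` if `q = f`. When `f` is a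
final state of `A` and the transitions preserve `ok`, all reachable states of the subset
automaton are of this form. -/
noncomputable def validStates {Q X : Type} [Fintype Q] [Fintype X] (I : Finset X)
    (ok : Finset X → Prop) (f : Q) : Finset (Q × Finset X) :=
  open Classical in {s | ok s.2 ∧ (s.1 = f → I ⊆ s.2)}

theorem mem_validStates {Q X : Type} [Fintype Q] [Fintype X] {I : Finset X}
    {ok : Finset X → Prop} {f : Q} {s : Q × Finset X} :
    s ∈ validStates I ok f ↔ ok s.2 ∧ (s.1 = f → I ⊆ s.2) := by
  classical
  simp [validStates]

section concat

variable {α Q X : Type} [DecidableEq X] (A : DFA α Q) (δ : X → α → X) (I F : Finset X)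

theorem mem_concatDFA_step {s : Q × Finset X} {l : α} {x : X} :
    x ∈ ((concatDFA A δ I F).step s l).2 ↔
      (∃ y ∈ s.2, δ y l = x) ∨ (A.step s.1 l ∈ A.accept ∧ x ∈ I) := by
  classical
  simp only [concatDFA, mem_union, mem_image]
  split_ifs with h <;> simp [h]

@[simp]
theorem concatDFA_step_fst (s : Q × Finset X) (l : α) :
    ((concatDFA A δ I F).step s l).1 = A.step s.1 l := rfl

theorem concatDFA_evalFrom_fst (s : Q × Finset X) (w : List α) :
    ((concatDFA A δ I F).evalFrom s w).1 = A.evalFrom s.1 w := by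
  induction w generalizing s with
  | nil => rfl
  | cons l w ih => simp [ih]

theorem concatDFA_step_of_notMem {q : Q} {l : α} (h : A.step q l ∉ A.accept) (S : Finset X) :
    (concatDFA A δ I F).step (q, S) l = (A.step q l, S.image (δ · l)) := by
  classical
  simp [concatDFA, h]

theorem concatDFA_step_of_mem {q : Q} {l : α} (h : A.step q l ∈ A.accept) (S : Finset X) :
    (concatDFA A δ I F).step (q, S) l = (A.step q l, S.image (δ · l) ∪ I) := by
  classical
  simp [concatDFA, h]

theorem mem_concatDFA_evalFrom {s : Q × Finset X} {w : List α} {x : X} (h : x ∈ s.2) :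
    w.foldl δ x ∈ ((concatDFA A δ I F).evalFrom s w).2 := by
  induction w generalizing s x with
  | nil => exact h
  | cons l w ih => exact ih ((mem_concatDFA_step A δ I F).2 (Or.inl ⟨x, h, rfl⟩))

theorem mem_concatDFA_eval {w : List α} {x : X} :
    x ∈ ((concatDFA A δ I F).eval w).2 ↔
      ∃ u v, u ++ v = w ∧ u ∈ A.accepts ∧ ∃ i ∈ I, v.foldl δ i = x := by
  classical
  induction w using List.reverseRecOn generalizing x with
  | nil =>
    have hst : ((concatDFA A δ I F).eval []).2 = if A.start ∈ A.accept then I else ∅ := rfl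
    rw [hst]
    constructor
    · intro h
      split_ifs at h with h1
      · exact ⟨[], [], rfl, h1, x, h, rfl⟩
      · simp at h
    · rintro ⟨u, v, huv, hu, i, hi, rfl⟩
      obtain ⟨rfl, rfl⟩ := List.append_eq_nil_iff.1 huv
      have hu' : A.start ∈ A.accept := hu
      simpa [hu'] using hi
  | append_singleton w l ih =>
    rw [DFA.eval_append_singleton, mem_concatDFA_step]
    have h1 : A.step ((concatDFA A δ I F).eval w).1 l = A.eval (w ++ [l]) := by
      rw [DFA.eval_append_singleton, DFA.eval, concatDFA_evalFrom_fst]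
      rfl
    rw [h1]
    constructor
    · rintro (⟨y, hy, rfl⟩ | ⟨hacc, hx⟩)
      · obtain ⟨u, v, rfl, hu, i, hi, rfl⟩ := ih.1 hy
        exact ⟨u, v ++ [l], by simp, hu, i, hi, by simp⟩
      · exact ⟨w ++ [l], [], by simp, hacc, x, hx, rfl⟩
    · rintro ⟨u, v, huv, hu, i, hi, rfl⟩
      rcases List.eq_nil_or_concat v with rfl | ⟨v', l', rfl⟩
      · right
        rw [List.append_nil] at huv
        subst huv
        exact ⟨hu, hi⟩
      · left
        rw [List.concat_eq_append, ← List.append_assoc] at huv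
        obtain ⟨rfl, h2⟩ := List.append_inj' huv rfl
        obtain rfl : l' = l := by simpa using h2
        exact ⟨v'.foldl δ i, ih.2 ⟨u, v', rfl, hu, i, hi, rfl⟩, by simp⟩

theorem concatDFA_accepts :
    (concatDFA A δ I F).accepts = A.accepts * actionLanguage δ I F := by
  ext w
  rw [DFA.mem_accepts, Language.mem_mul]
  constructor
  · rintro ⟨x, hx, hF⟩
    obtain ⟨u, v, rfl, hu, i, hi, rfl⟩ := (mem_concatDFA_eval A δ I F).1 hx
    exact ⟨u, hu, v, ⟨i, hi, hF⟩, rfl⟩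
  · rintro ⟨u, hu, v, ⟨i, hi, hF⟩, rfl⟩
    exact ⟨_, (mem_concatDFA_eval A δ I F).2 ⟨u, v, rfl, hu, i, hi, rfl⟩, hF⟩

theorem start_mem_validStates [Fintype Q] [Fintype X] {ok : Finset X → Prop} {f : Q}
    (hf : f ∈ A.accept) (h0 : ok ∅) (hI : ok I) :
    (concatDFA A δ I F).start ∈ validStates I ok f := by
  classical
  rw [mem_validStates]
  by_cases h : A.start ∈ A.accept
  · simp [concatDFA, h, hI]
  · have : A.start ≠ f := fun e => h (e ▸ hf)
    simp [concatDFA, h, h0, this]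

theorem step_mem_validStates [Fintype Q] [Fintype X] {ok : Finset X → Prop} {f : Q}
    (hf : f ∈ A.accept) (himage : ∀ S l, ok S → ok (S.image (δ · l)))
    (hunion : ∀ S, ok S → ok (S ∪ I)) :
    ∀ s ∈ validStates I ok f, ∀ l, (concatDFA A δ I F).step s l ∈ validStates I ok f := by
  rintro ⟨q, S⟩ hs l
  rw [mem_validStates] at hs ⊢
  by_cases h : A.step q l ∈ A.accept
  · rw [concatDFA_step_of_mem A δ I F h]
    exact ⟨hunion _ (himage _ _ hs.1), fun _ => subset_union_right⟩
  · rw [concatDFA_step_of_notMem A δ I F h]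
    exact ⟨himage _ _ hs.1, fun e => absurd (by rwa [show A.step q l = f from e]) h⟩

end concat

theorem card_validStates {m : ℕ} {X : Type} [Fintype X] (I : Finset X)
    (ok : Finset X → Prop) (f : Fin m) :
    #(validStates I ok f) =
      (m - 1) * {S : Finset X | ok S}.ncard + {S : Finset X | ok S ∧ I ⊆ S}.ncard := by
  classical
  have h : validStates I ok f =
      (univ.erase f) ×ˢ (univ.filter fun S => ok S) ∪
        {f} ×ˢ (univ.filter fun S => ok S ∧ I ⊆ S) := by
    ext ⟨q, S⟩
    simp only [mem_validStates, mem_union, mem_product, mem_erase, mem_univ, mem_filter,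
      mem_singleton, true_and, and_true]
    tauto
  have hd : Disjoint ((univ.erase f) ×ˢ (univ.filter fun S => ok S))
      ({f} ×ˢ (univ.filter fun S => ok S ∧ I ⊆ S)) := by
    rw [disjoint_left]
    rintro ⟨q, S⟩ h1 h2
    simp only [mem_product, mem_erase, mem_singleton] at h1 h2
    exact h1.1.1 h2.1
  rw [h, card_union_of_disjoint hd, card_product, card_product, card_singleton, one_mul,
    card_erase_of_mem (mem_univ f), card_univ, Fintype.card_fin,
    Set.ncard_eq_toFinset_card', Set.ncard_eq_toFinset_card', Set.toFinset_ofPred,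
    Set.toFinset_ofPred]

/-! ### Concatenation with an intersection or a union -/

/-- Both or none of the two parts of a subset of a disjoint union are nonempty. Initial states of
the two automata are added at the same time, so this holds of the sets that occur in `unionDFA`. -/
def SidesBalanced {P R : Type} (S : Finset (P ⊕ R)) : Prop :=
  (∃ i, Sum.inl i ∈ S) ↔ ∃ j, Sum.inr j ∈ S

theorem sidesBalanced_empty {P R : Type} : SidesBalanced (∅ : Finset (P ⊕ R)) := by
  simp [SidesBalanced]

theorem SidesBalanced.of_mem {P R : Type} {S : Finset (P ⊕ R)} {i : P} {j : R} (hi : Sum.inl i ∈ S)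
    (hj : Sum.inr j ∈ S) : SidesBalanced S :=
  ⟨fun _ => ⟨j, hj⟩, fun _ => ⟨i, hi⟩⟩

section actions

variable {α P R : Type}

/-- The letters act on the pairs of a state of `B` and a state of `C`. -/
def prodAction (B : DFA α P) (C : DFA α R) (x : P × R) (l : α) : P × R :=
  (B.step x.1 l, C.step x.2 l)

/-- The letters act on the disjoint union of the states of `B` and the states of `C`. -/
def sumAction (B : DFA α P) (C : DFA α R) (x : P ⊕ R) (l : α) : P ⊕ R :=
  x.map (B.step · l) (C.step · l)

theorem foldl_prodAction (B : DFA α P) (C : DFA α R) (w : List α) (x : P × R) :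
    w.foldl (prodAction B C) x = (B.evalFrom x.1 w, C.evalFrom x.2 w) := by
  induction w generalizing x with
  | nil => rfl
  | cons l w ih => exact ih _

theorem foldl_sumAction_inl (B : DFA α P) (C : DFA α R) (w : List α) (x : P) :
    w.foldl (sumAction B C) (Sum.inl x) = Sum.inl (B.evalFrom x w) := by
  induction w generalizing x with
  | nil => rfl
  | cons l w ih => exact ih _

theorem foldl_sumAction_inr (B : DFA α P) (C : DFA α R) (w : List α) (x : R) :
    w.foldl (sumAction B C) (Sum.inr x) = Sum.inr (C.evalFrom x w) := by
  induction w generalizing x with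
  | nil => rfl
  | cons l w ih => exact ih _

theorem sidesBalanced_image_sumAction [DecidableEq P] [DecidableEq R] (B : DFA α P)
    (C : DFA α R) (S : Finset (P ⊕ R)) (l : α) :
    SidesBalanced (S.image (sumAction B C · l)) ↔ SidesBalanced S := by
  have h1 : (∃ i, Sum.inl i ∈ S.image (sumAction B C · l)) ↔ ∃ i, Sum.inl i ∈ S := by
    constructor
    · rintro ⟨i, hi⟩
      obtain ⟨x | x, hx, h⟩ := mem_image.1 hi
      · exact ⟨x, hx⟩
      · cases h
    · rintro ⟨i, hi⟩
      exact ⟨_, mem_image_of_mem _ hi⟩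
  have h2 : (∃ i, Sum.inr i ∈ S.image (sumAction B C · l)) ↔ ∃ i, Sum.inr i ∈ S := by
    constructor
    · rintro ⟨i, hi⟩
      obtain ⟨x | x, hx, h⟩ := mem_image.1 hi
      · cases h
      · exact ⟨x, hx⟩
    · rintro ⟨i, hi⟩
      exact ⟨_, mem_image_of_mem _ hi⟩
  rw [SidesBalanced, h1, h2, SidesBalanced]

variable [Fintype P] [Fintype R]

/-- The pairs of final states. -/
noncomputable def prodFinal (B : DFA α P) (C : DFA α R) : Finset (P × R) :=
  open Classical in {x | x.1 ∈ B.accept ∧ x.2 ∈ C.accept}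

/-- The final states of `B` and those of `C`, side by side. -/
noncomputable def sumFinal (B : DFA α P) (C : DFA α R) : Finset (P ⊕ R) :=
  open Classical in {x | x.elim (· ∈ B.accept) (· ∈ C.accept)}

theorem mem_prodFinal {B : DFA α P} {C : DFA α R} {x : P × R} :
    x ∈ prodFinal B C ↔ x.1 ∈ B.accept ∧ x.2 ∈ C.accept := by
  classical
  simp [prodFinal]

theorem inl_mem_sumFinal {B : DFA α P} {C : DFA α R} {x : P} :
    Sum.inl x ∈ sumFinal B C ↔ x ∈ B.accept := by
  classical
  simp [sumFinal]

theorem inr_mem_sumFinal {B : DFA α P} {C : DFA α R} {x : R} :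
    Sum.inr x ∈ sumFinal B C ↔ x ∈ C.accept := by
  classical
  simp [sumFinal]

variable [DecidableEq P] [DecidableEq R]

/-- The subset automaton for `L(A) · (L(B) ∩ L(C))`. -/
noncomputable def interDFA {Q : Type} (A : DFA α Q) (B : DFA α P) (C : DFA α R) :
    DFA α (Q × Finset (P × R)) :=
  concatDFA A (prodAction B C) {(B.start, C.start)} (prodFinal B C)

/-- The subset automaton for `L(A) · (L(B) ∪ L(C))`. -/
noncomputable def unionDFA {Q : Type} (A : DFA α Q) (B : DFA α P) (C : DFA α R) :
    DFA α (Q × Finset (P ⊕ R)) :=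
  concatDFA A (sumAction B C) {Sum.inl B.start, Sum.inr C.start} (sumFinal B C)

theorem interDFA_accepts {Q : Type} (A : DFA α Q) (B : DFA α P) (C : DFA α R) :
    (interDFA A B C).accepts = catInter A.accepts B.accepts C.accepts := by
  rw [interDFA, concatDFA_accepts, catInter]
  congr 1
  ext w
  constructor
  · rintro ⟨x, hx, hF⟩
    rw [mem_singleton] at hx
    subst hx
    rw [foldl_prodAction, mem_prodFinal] at hF
    exact hF
  · rintro ⟨h1, h2⟩
    refine ⟨_, mem_singleton_self _, ?_⟩
    rw [foldl_prodAction, mem_prodFinal]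
    exact ⟨h1, h2⟩

theorem unionDFA_accepts {Q : Type} (A : DFA α Q) (B : DFA α P) (C : DFA α R) :
    (unionDFA A B C).accepts = catUnion A.accepts B.accepts C.accepts := by
  rw [unionDFA, concatDFA_accepts, catUnion]
  congr 1
  ext w
  constructor
  · rintro ⟨x, hx, hF⟩
    rw [mem_insert, mem_singleton] at hx
    rcases hx with rfl | rfl
    · rw [foldl_sumAction_inl, inl_mem_sumFinal] at hF
      exact Or.inl hF
    · rw [foldl_sumAction_inr, inr_mem_sumFinal] at hF
      exact Or.inr hF
  · rintro (h | h)
    · refine ⟨Sum.inl B.start, by simp, ?_⟩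
      rw [foldl_sumAction_inl, inl_mem_sumFinal]
      exact h
    · refine ⟨Sum.inr C.start, by simp, ?_⟩
      rw [foldl_sumAction_inr, inr_mem_sumFinal]
      exact h

/-- The valid states of `interDFA`. -/
noncomputable def interStates {Q : Type} [Fintype Q] (B : DFA α P) (C : DFA α R) (f : Q) :
    Finset (Q × Finset (P × R)) :=
  validStates {(B.start, C.start)} (fun _ => True) f

/-- The valid states of `unionDFA`. -/
noncomputable def unionStates {Q : Type} [Fintype Q] (B : DFA α P) (C : DFA α R) (f : Q) :
    Finset (Q × Finset (P ⊕ R)) :=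
  validStates {Sum.inl B.start, Sum.inr C.start} SidesBalanced f

variable {Q : Type} [Fintype Q] (A : DFA α Q) (B : DFA α P) (C : DFA α R) {f : Q}

theorem start_mem_interStates (hf : f ∈ A.accept) :
    (interDFA A B C).start ∈ interStates B C f :=
  start_mem_validStates _ _ _ _ hf trivial trivial

theorem step_mem_interStates (hf : f ∈ A.accept) :
    ∀ s ∈ interStates B C f, ∀ l, (interDFA A B C).step s l ∈ interStates B C f :=
  step_mem_validStates _ _ _ _ hf (fun _ _ _ => trivial) (fun _ _ => trivial)

theorem start_mem_unionStates (hf : f ∈ A.accept) :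
    (unionDFA A B C).start ∈ unionStates B C f :=
  start_mem_validStates _ _ _ _ hf sidesBalanced_empty
    (SidesBalanced.of_mem (i := B.start) (j := C.start) (by simp) (by simp))

theorem step_mem_unionStates (hf : f ∈ A.accept) :
    ∀ s ∈ unionStates B C f, ∀ l, (unionDFA A B C).step s l ∈ unionStates B C f :=
  step_mem_validStates _ _ _ _ hf (fun S l h => (sidesBalanced_image_sumAction B C S l).2 h)
    (fun S _ => SidesBalanced.of_mem (i := B.start) (j := C.start) (by simp) (by simp))

end actions

theorem ncard_superset {X : Type} [Fintype X] (I : Finset X) :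
    {S : Finset X | I ⊆ S}.ncard = 2 ^ (Fintype.card X - #I) := by
  classical
  rw [← Finset.card_univ, ← Finset.card_Icc_finset (subset_univ I), ← Set.ncard_coe_finset]
  congr 1
  ext S
  simp

theorem card_interStates {α : Type} {m n p : ℕ} (B : DFA α (Fin n)) (C : DFA α (Fin p))
    (f : Fin m) : #(interStates B C f) = (m - 1) * 2 ^ (n * p) + 2 ^ (n * p - 1) := by
  rw [interStates, card_validStates]
  simp only [true_and]
  rw [ncard_superset]
  simp [Set.ncard_univ]

theorem ncard_sidesBalanced (n p : ℕ) :
    {S : Finset (Fin n ⊕ Fin p) | SidesBalanced S}.ncard = (2 ^ n - 1) * (2 ^ p - 1) + 1 := by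
  have h : {S : Finset (Fin n ⊕ Fin p) | SidesBalanced S} =
      ((insert (∅, ∅) ((univ.erase ∅) ×ˢ (univ.erase ∅)) :
        Finset (Finset (Fin n) × Finset (Fin p))).map sumEquiv.symm.toEquiv.toEmbedding :) := by
    ext S
    obtain ⟨⟨S₁, S₂⟩, rfl⟩ := sumEquiv.symm.surjective S
    have : (sumEquiv.symm.toEquiv.symm (S₁.disjSum S₂)) = (S₁, S₂) := by
      rw [Equiv.symm_apply_eq]; rfl
    rw [mem_coe, mem_map_equiv, sumEquiv_symm_apply, this]
    simp only [Set.mem_ofPred_eq, mem_insert, mem_product, mem_erase, mem_univ,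
      and_true, SidesBalanced, inl_mem_disjSum, inr_mem_disjSum, Prod.mk.injEq]
    rw [← Finset.nonempty_iff_ne_empty, ← Finset.nonempty_iff_ne_empty,
      ← Finset.not_nonempty_iff_eq_empty, ← Finset.not_nonempty_iff_eq_empty]
    simp only [Finset.Nonempty]
    tauto
  rw [h, Set.ncard_coe_finset, card_map, card_insert_of_notMem (by simp), card_product,
    card_erase_of_mem (mem_univ _), card_erase_of_mem (mem_univ _)]
  simp

theorem card_unionStates {α : Type} {m n p : ℕ} (B : DFA α (Fin n)) (C : DFA α (Fin p))
    (f : Fin m) : #(unionStates B C f) =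
      (m - 1) * (2 ^ (n + p) - 2 ^ n - 2 ^ p + 2) + 2 ^ (n + p - 2) := by
  rw [unionStates, card_validStates, ncard_sidesBalanced]
  have h : {S : Finset (Fin n ⊕ Fin p) |
      SidesBalanced S ∧ {Sum.inl B.start, Sum.inr C.start} ⊆ S} =
      {S | {Sum.inl B.start, Sum.inr C.start} ⊆ S} := by
    ext S
    simp only [Set.mem_ofPred_eq, and_iff_right_iff_imp]
    intro h
    exact SidesBalanced.of_mem (i := B.start) (j := C.start) (h (by simp)) (h (by simp))
  rw [h, ncard_superset, card_pair (by simp)]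
  have hn : 2 ≤ 2 ^ n := by
    have := Nat.pow_le_pow_right (n := 2) two_pos (Fin.pos B.start)
    simpa using this
  have hp : 2 ≤ 2 ^ p := by
    have := Nat.pow_le_pow_right (n := 2) two_pos (Fin.pos C.start)
    simpa using this
  have e : (2 ^ n - 1) * (2 ^ p - 1) + 1 = 2 ^ (n + p) - 2 ^ n - 2 ^ p + 2 := by
    rw [pow_add]
    obtain ⟨x, hx⟩ := Nat.exists_eq_add_of_le hn
    obtain ⟨y, hy⟩ := Nat.exists_eq_add_of_le hp
    rw [hx, hy]
    have e1 : (2 + x) * (2 + y) = (2 + x) + (2 + y) + (x + y + x * y) := by ring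
    have e2 : (2 + x - 1) * (2 + y - 1) = x + y + x * y + 1 := by
      rw [show 2 + x - 1 = 1 + x by omega, show 2 + y - 1 = 1 + y by omega]
      ring
    omega
  rw [e]
  simp

/-- A language of state complexity at least `2` is not empty, so its automata have final states. -/
theorem exists_mem_accept {α : Type} {k : ℕ} (hk : 2 ≤ k) {M : DFA α (Fin k)}
    (h : stateComplexity M.accepts = k) : ∃ f, f ∈ M.accept := by
  by_contra! hM
  let N : DFA α (Fin 1) := { step := fun q _ => q, start := 0, accept := ∅ }
  have : N.accepts = M.accepts := by
    ext w
    exact ⟨fun h => absurd h (Set.notMem_empty _), fun h => absurd h (hM _)⟩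
  have := stateComplexity_le_of_dfa N this
  omega

theorem stateComplexity_catInter_le {α : Type} {m n p : ℕ} (hm : 2 ≤ m) (hn : n ≠ 0) (hp : p ≠ 0)
    {L₁ L₂ L₃ : Language α} (h₁ : stateComplexity L₁ = m) (h₂ : stateComplexity L₂ = n)
    (h₃ : stateComplexity L₃ = p) :
    stateComplexity (catInter L₁ L₂ L₃) ≤ (m - 1) * 2 ^ (n * p) + 2 ^ (n * p - 1) := by
  obtain ⟨A, rfl⟩ := exists_dfa_of_stateComplexity (by omega) h₁
  obtain ⟨B, rfl⟩ := exists_dfa_of_stateComplexity hn h₂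
  obtain ⟨C, rfl⟩ := exists_dfa_of_stateComplexity hp h₃
  obtain ⟨f, hf⟩ := exists_mem_accept hm h₁
  rw [← interDFA_accepts, ← card_interStates B C f]
  exact stateComplexity_accepts_le _ _ (start_mem_interStates A B C hf)
    (step_mem_interStates A B C hf)

theorem stateComplexity_catUnion_le {α : Type} {m n p : ℕ} (hm : 2 ≤ m) (hn : n ≠ 0) (hp : p ≠ 0)
    {L₁ L₂ L₃ : Language α} (h₁ : stateComplexity L₁ = m) (h₂ : stateComplexity L₂ = n)
    (h₃ : stateComplexity L₃ = p) :
    stateComplexity (catUnion L₁ L₂ L₃) ≤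
      (m - 1) * (2 ^ (n + p) - 2 ^ n - 2 ^ p + 2) + 2 ^ (n + p - 2) := by
  obtain ⟨A, rfl⟩ := exists_dfa_of_stateComplexity (by omega) h₁
  obtain ⟨B, rfl⟩ := exists_dfa_of_stateComplexity hn h₂
  obtain ⟨C, rfl⟩ := exists_dfa_of_stateComplexity hp h₃
  obtain ⟨f, hf⟩ := exists_mem_accept hm h₁
  rw [← unionDFA_accepts, ← card_unionStates B C f]
  exact stateComplexity_accepts_le _ _ (start_mem_unionStates A B C hf)
    (step_mem_unionStates A B C hf)

/-! ### The witness automata -/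

instance : Finite Letter :=
  Finite.of_surjective (fun i : Fin 3 => ![Letter.a, Letter.b, Letter.c] i) (by
    rintro (_ | _ | _)
    exacts [⟨0, rfl⟩, ⟨1, rfl⟩, ⟨2, rfl⟩])

/-- The automaton of `witnessA`. -/
def autA (m : ℕ) (hm : 2 ≤ m) : DFA Letter (Fin m) :=
  brzozowski m hm (some Letter.a) (some Letter.b) none

/-- The automaton of `witnessB`. -/
def autB (n : ℕ) (hn : 2 ≤ n) : DFA Letter (Fin n) :=
  brzozowski n hn (some Letter.b) (some Letter.a) (some Letter.c)

/-- The automaton of `witnessC`. -/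
def autC (p : ℕ) (hp : 2 ≤ p) : DFA Letter (Fin p) :=
  brzozowski p hp (some Letter.b) none (some Letter.c)

theorem two_le_of_three_le {k : ℕ} (hk : 3 ≤ k) : 2 ≤ k :=
  Nat.le_of_succ_le hk

theorem succ_mod_eq_ite {n q : ℕ} (h : q < n) :
    (q + 1) % n = if q + 1 = n then 0 else q + 1 := by
  split_ifs with h1
  · rw [h1, Nat.mod_self]
  · exact Nat.mod_eq_of_lt (by omega)

theorem brzozowski_step_cycle {α : Type} [DecidableEq α] {n : ℕ} (hn : 2 ≤ n) (s : α)
    (σ₂ σ₃ : Option α) (q : Fin n) :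
    ((brzozowski n hn (some s) σ₂ σ₃).step q s).val = if q.val + 1 = n then 0 else q.val + 1 := by
  rw [← succ_mod_eq_ite q.2]
  simp [brzozowski]

theorem swap_val {n : ℕ} (hn : 2 ≤ n) (q : Fin n) :
    (Equiv.swap (⟨0, by omega⟩ : Fin n) ⟨1, by omega⟩ q).val =
      if q.val = 0 then 1 else if q.val = 1 then 0 else q.val := by
  rw [Equiv.swap_apply_def]
  simp only [Fin.ext_iff]
  split_ifs <;> rfl

section witness

variable {m n p : ℕ}

theorem autA_step_a (hm : 2 ≤ m) (q : Fin m) :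
    ((autA m hm).step q .a).val = if q.val + 1 = m then 0 else q.val + 1 :=
  brzozowski_step_cycle _ _ _ _ q

theorem autA_step_b (hm : 2 ≤ m) (q : Fin m) :
    ((autA m hm).step q .b).val = if q.val = 0 then 1 else if q.val = 1 then 0 else q.val := by
  rw [← swap_val hm]
  simp [autA, brzozowski]

theorem autA_step_c (hm : 2 ≤ m) (q : Fin m) : (autA m hm).step q .c = q := by
  simp [autA, brzozowski]

theorem autB_step_a (hn : 2 ≤ n) (q : Fin n) :
    ((autB n hn).step q .a).val = if q.val = 0 then 1 else if q.val = 1 then 0 else q.val := by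
  rw [← swap_val hn]
  simp [autB, brzozowski]

theorem autB_step_b (hn : 2 ≤ n) (q : Fin n) :
    ((autB n hn).step q .b).val = if q.val + 1 = n then 0 else q.val + 1 :=
  brzozowski_step_cycle _ _ _ _ q

theorem autB_step_c (hn : 2 ≤ n) (q : Fin n) :
    ((autB n hn).step q .c).val = if q.val = 1 then 0 else q.val := by
  simp only [autB, brzozowski]
  simp
  split_ifs <;> rfl

theorem autC_step_a (hp : 2 ≤ p) (q : Fin p) : (autC p hp).step q .a = q := by
  simp [autC, brzozowski]

theorem autC_step_b (hp : 2 ≤ p) (q : Fin p) :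
    ((autC p hp).step q .b).val = if q.val + 1 = p then 0 else q.val + 1 :=
  brzozowski_step_cycle _ _ _ _ q

theorem autC_step_c (hp : 2 ≤ p) (q : Fin p) :
    ((autC p hp).step q .c).val = if q.val = 1 then 0 else q.val := by
  simp only [autC, brzozowski]
  simp
  split_ifs <;> rfl

theorem mem_autA_accept (hm : 2 ≤ m) {q : Fin m} : q ∈ (autA m hm).accept ↔ q.val = m - 1 := by
  simp [autA, brzozowski, Fin.ext_iff]

theorem mem_autB_accept (hn : 2 ≤ n) {q : Fin n} : q ∈ (autB n hn).accept ↔ q.val = n - 1 := by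
  simp [autB, brzozowski, Fin.ext_iff]

theorem mem_autC_accept (hp : 2 ≤ p) {q : Fin p} : q ∈ (autC p hp).accept ↔ q.val = p - 1 := by
  simp [autC, brzozowski, Fin.ext_iff]

theorem autB_start_val (hn : 2 ≤ n) : (autB n hn).start.val = 0 := rfl

theorem autA_step_a_injective (hm : 2 ≤ m) : Function.Injective ((autA m hm).step · .a) := by
  intro x y h
  have := congrArg Fin.val h
  simp only [autA_step_a] at this
  have := x.2
  have := y.2
  ext
  split_ifs at * <;> omega

theorem autB_step_a_bijective (hn : 2 ≤ n) : Function.Bijective ((autB n hn).step · .a) := by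
  rw [← Finite.injective_iff_bijective]
  intro x y h
  have := congrArg Fin.val h
  simp only [autB_step_a] at this
  ext
  split_ifs at * <;> omega

theorem autB_step_b_bijective (hn : 2 ≤ n) : Function.Bijective ((autB n hn).step · .b) := by
  rw [← Finite.injective_iff_bijective]
  intro x y h
  have := congrArg Fin.val h
  simp only [autB_step_b] at this
  have := x.2
  have := y.2
  ext
  split_ifs at * <;> omega

theorem autC_step_a_bijective (hp : 2 ≤ p) : Function.Bijective ((autC p hp).step · .a) := by
  simp only [autC_step_a]
  exact Function.bijective_id

theorem autC_step_b_bijective (hp : 2 ≤ p) : Function.Bijective ((autC p hp).step · .b) := by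
  rw [← Finite.injective_iff_bijective]
  intro x y h
  have := congrArg Fin.val h
  simp only [autC_step_b] at this
  have := x.2
  have := y.2
  ext
  split_ifs at * <;> omega

/-- An automaton `𝒳ₙ` in which some letter acts as the cycle is minimal. -/
theorem stateComplexity_brzozowski {α : Type} [DecidableEq α] {n : ℕ} (hn : 2 ≤ n) (s : α)
    (σ₂ σ₃ : Option α) : stateComplexity (brzozowski n hn (some s) σ₂ σ₃).accepts = n := by
  set M := brzozowski n hn (some s) σ₂ σ₃ with hM
  have hpow : ∀ k (q : Fin n), (M.evalFrom q (List.replicate k s)).val = (q.val + k) % n := by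
    intro k
    induction k with
    | zero => intro q; exact (Nat.mod_eq_of_lt q.2).symm
    | succ k ih =>
      intro q
      have h1 : (M.step q s).val = (q.val + 1) % n := by simp [hM, brzozowski]
      rw [List.replicate_succ, DFA.evalFrom_cons, ih, h1, Nat.mod_add_mod]
      congr 1
      ring
  have hacc : ∀ q : Fin n, q ∈ M.accept ↔ q.val = n - 1 := by
    intro q
    simp [hM, brzozowski, Fin.ext_iff]
  -- the power of the cycle that leads `q` to the final state leads no other state there
  have key : ∀ q q' : Fin n, M.acceptsFrom q = M.acceptsFrom q' → q = q' := by
    intro q q' h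
    have h1 : List.replicate (n - 1 - q.val) s ∈ M.acceptsFrom q := by
      rw [DFA.mem_acceptsFrom, hacc, hpow, Nat.mod_eq_of_lt (by omega)]
      omega
    rw [h, DFA.mem_acceptsFrom, hacc, hpow] at h1
    have hlt : q'.val + (n - 1 - q.val) < n + n := by omega
    ext
    rcases Nat.lt_or_ge (q'.val + (n - 1 - q.val)) n with h2 | h2
    · rw [Nat.mod_eq_of_lt h2] at h1
      omega
    · rw [Nat.mod_eq_sub_mod h2, Nat.mod_eq_of_lt (by omega)] at h1
      omega
  rw [stateComplexity_accepts_eq M univ (mem_univ _) (fun _ _ _ => mem_univ _), card_univ,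
    Fintype.card_fin]
  · intro q _
    refine ⟨List.replicate q.val s, ?_⟩
    ext
    rw [DFA.eval, hpow]
    have : M.start.val = 0 := rfl
    rw [this, Nat.zero_add, Nat.mod_eq_of_lt q.2]
  · intro q _ q' _ h
    exact key q q' h

theorem brzozowski_mem_languagesOfComplexity {α : Type} [DecidableEq α] {n : ℕ} (hn : 2 ≤ n)
    (s : α) (σ₂ σ₃ : Option α) :
    (brzozowski n hn (some s) σ₂ σ₃).accepts ∈ languagesOfComplexity α n :=
  ⟨⟨Fin n, inferInstance, _, rfl⟩, stateComplexity_brzozowski hn s σ₂ σ₃⟩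

/-! ### Loop words -/

/-- The products of the words `ab` and `bb`. They lead the automaton `autA` from the state `0` back
to `0` through the states `0` and `1` only, so that no final state is entered on the way. -/
inductive IsLoopWord : List Letter → Prop
  | nil : IsLoopWord []
  | ab {w : List Letter} : IsLoopWord w → IsLoopWord (.a :: .b :: w)
  | bb {w : List Letter} : IsLoopWord w → IsLoopWord (.b :: .b :: w)

theorem IsLoopWord.append {u v : List Letter} (hu : IsLoopWord u) (hv : IsLoopWord v) :
    IsLoopWord (u ++ v) := by
  induction hu with
  | nil => exact hv
  | ab _ ih => exact ih.ab
  | bb _ ih => exact ih.bb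

theorem IsLoopWord.foldl_bijective {X : Type} {δ : X → Letter → X}
    (ha : Function.Bijective (δ · .a)) (hb : Function.Bijective (δ · .b)) {w : List Letter}
    (hw : IsLoopWord w) : Function.Bijective fun x => w.foldl δ x := by
  induction hw with
  | nil => exact Function.bijective_id
  | ab _ ih => exact ih.comp (hb.comp ha)
  | bb _ ih => exact ih.comp (hb.comp hb)

/-- Loop words cyclically shift the states of `autC`. -/
theorem IsLoopWord.exists_autC_evalFrom (hp : 2 ≤ p) {w : List Letter} (hw : IsLoopWord w) :
    ∃ k, ∀ j : Fin p, ((autC p hp).evalFrom j w).val = (j.val + k) % p := by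
  have hb : ∀ j : Fin p, ((autC p hp).step j .b).val = (j.val + 1) % p := by
    intro j
    rw [autC_step_b, succ_mod_eq_ite j.2]
  induction hw with
  | nil => exact ⟨0, fun j => (Nat.mod_eq_of_lt j.2).symm⟩
  | ab _ ih =>
    obtain ⟨k, hk⟩ := ih
    refine ⟨1 + k, fun j => ?_⟩
    rw [DFA.evalFrom_cons, DFA.evalFrom_cons, hk, autC_step_a, hb, Nat.mod_add_mod, Nat.add_assoc]
  | bb _ ih =>
    obtain ⟨k, hk⟩ := ih
    refine ⟨1 + (1 + k), fun j => ?_⟩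
    rw [DFA.evalFrom_cons, DFA.evalFrom_cons, hk, hb, hb, Nat.mod_add_mod, Nat.add_assoc,
      Nat.mod_add_mod, Nat.add_assoc]

end witness

section loops

variable {n p : ℕ}

theorem exists_isLoopWord_trans {σ : Type} {M : DFA Letter σ} {P Q : σ → Prop} {q : σ}
    (h₁ : ∃ w, IsLoopWord w ∧ P (M.evalFrom q w))
    (h₂ : ∀ q', P q' → ∃ w, IsLoopWord w ∧ Q (M.evalFrom q' w)) :
    ∃ w, IsLoopWord w ∧ Q (M.evalFrom q w) := by
  obtain ⟨u, hu, hP⟩ := h₁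
  obtain ⟨v, hv, hQ⟩ := h₂ _ hP
  exact ⟨u ++ v, hu.append hv, by rwa [DFA.evalFrom_of_append]⟩

theorem autB_evalFrom_ab (hn : 2 ≤ n) (i : Fin n) :
    ((autB n hn).evalFrom i [.a, .b]).val =
      if i.val = 0 then (if n = 2 then 0 else 2) else if i.val = 1 then 1 else
        if i.val + 1 = n then 0 else i.val + 1 := by
  simp only [DFA.evalFrom_cons, DFA.evalFrom_nil, autB_step_a, autB_step_b]
  split_ifs <;> omega

theorem autB_evalFrom_bb (hn : 2 ≤ n) (i : Fin n) :
    ((autB n hn).evalFrom i [.b, .b]).val =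
      if i.val + 1 = n then 1 else if i.val + 2 = n then 0 else i.val + 2 := by
  simp only [DFA.evalFrom_cons, DFA.evalFrom_nil, autB_step_b]
  split_ifs <;> omega

/-- From the states `2, 3, …` of `autB`, powers of `ab` lead to every larger one. -/
theorem exists_isLoopWord_autB_le (hn : 3 ≤ n) {k : ℕ} (hk : k < n) (i : Fin n)
    (hi : 2 ≤ i.val) (hik : i.val ≤ k) :
    ∃ w, IsLoopWord w ∧ ((autB n (two_le_of_three_le hn)).evalFrom i w).val = k := by
  induction k, hik using Nat.le_induction with
  | base => exact ⟨[], .nil, rfl⟩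
  | succ k hle ih =>
    refine exists_isLoopWord_trans (P := fun q : Fin n => q.val = k)
      (Q := fun q : Fin n => q.val = k + 1)
      (ih (by omega)) ?_
    intro q hq
    refine ⟨_, IsLoopWord.nil.ab, ?_⟩
    rw [autB_evalFrom_ab]
    split_ifs <;> omega

theorem exists_isLoopWord_autB_zero (hn : 3 ≤ n) (i : Fin n) (hi : 2 ≤ i.val) :
    ∃ w, IsLoopWord w ∧ ((autB n (two_le_of_three_le hn)).evalFrom i w).val = 0 := by
  refine exists_isLoopWord_trans (P := fun q : Fin n => q.val = n - 1)
      (Q := fun q : Fin n => q.val = 0)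
    (exists_isLoopWord_autB_le hn (by omega) i hi (by omega)) ?_
  intro q hq
  refine ⟨_, IsLoopWord.nil.ab, ?_⟩
  rw [autB_evalFrom_ab]
  split_ifs <;> omega

theorem exists_isLoopWord_autB_to_one (hn : 3 ≤ n) (i : Fin n) :
    ∃ w, IsLoopWord w ∧ ((autB n (two_le_of_three_le hn)).evalFrom i w).val = 1 := by
  have h2 : ∀ i : Fin n, 2 ≤ i.val →
      ∃ w, IsLoopWord w ∧ ((autB n (two_le_of_three_le hn)).evalFrom i w).val = 1 := by
    intro i hi
    refine exists_isLoopWord_trans (P := fun q : Fin n => q.val = n - 1)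
      (Q := fun q : Fin n => q.val = 1)
      (exists_isLoopWord_autB_le hn (by omega) i hi (by omega)) ?_
    intro q hq
    refine ⟨_, IsLoopWord.nil.bb, ?_⟩
    rw [autB_evalFrom_bb]
    split_ifs <;> omega
  rcases Nat.lt_trichotomy i.val 1 with h | h | h
  · refine exists_isLoopWord_trans (P := fun q : Fin n => 2 ≤ q.val)
      (Q := fun q : Fin n => q.val = 1)
      ⟨_, IsLoopWord.nil.ab, ?_⟩ h2
    rw [autB_evalFrom_ab]
    split_ifs <;> omega
  · exact ⟨[], .nil, h⟩
  · exact h2 i h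

theorem exists_isLoopWord_autB_of_one (hn : 3 ≤ n) (i : Fin n) (hi : i.val = 1) {k : ℕ}
    (hk : k < n) : ∃ w, IsLoopWord w ∧ ((autB n (two_le_of_three_le hn)).evalFrom i w).val = k := by
  have h0 : ∃ w, IsLoopWord w ∧ ((autB n (two_le_of_three_le hn)).evalFrom i w).val = 0 := by
    refine exists_isLoopWord_trans (P := fun q : Fin n => q.val = 0 ∨ 2 ≤ q.val)
      (Q := fun q : Fin n => q.val = 0)
      ⟨_, IsLoopWord.nil.bb, ?_⟩ ?_
    · rw [autB_evalFrom_bb]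
      split_ifs <;> omega
    · rintro q (hq | hq)
      · exact ⟨[], .nil, hq⟩
      · exact exists_isLoopWord_autB_zero hn q hq
  rcases Nat.lt_trichotomy k 1 with h | rfl | h
  · obtain rfl : k = 0 := by omega
    exact h0
  · exact ⟨[], .nil, hi⟩
  · refine exists_isLoopWord_trans (P := fun q : Fin n => q.val = 2)
      (Q := fun q : Fin n => q.val = k)
      (exists_isLoopWord_trans (P := fun q : Fin n => q.val = 0)
      (Q := fun q : Fin n => q.val = 2) h0 ?_) ?_
    · intro q hq
      refine ⟨_, IsLoopWord.nil.ab, ?_⟩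
      rw [autB_evalFrom_ab]
      split_ifs <;> omega
    · intro q hq
      exact exists_isLoopWord_autB_le hn hk q hq.ge (hq.trans_le h)

/-- Powers of `ab` fix the state `1` of `autB` and shift the states of `autC` arbitrarily. -/
theorem exists_isLoopWord_shift (hn : 3 ≤ n) (hp : 2 ≤ p) (i : Fin n) (hi : i.val = 1) (k : ℕ) :
    ∃ w, IsLoopWord w ∧ (autB n (two_le_of_three_le hn)).evalFrom i w = i ∧
      ∀ j : Fin p, ((autC p hp).evalFrom j w).val = (j.val + k) % p := by
  induction k with
  | zero => exact ⟨[], .nil, rfl, fun j => (Nat.mod_eq_of_lt j.2).symm⟩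
  | succ k ih =>
    obtain ⟨w, hw, h1, h2⟩ := ih
    refine ⟨w ++ [.a, .b], hw.append IsLoopWord.nil.ab, ?_, ?_⟩
    · rw [DFA.evalFrom_of_append, h1]
      ext
      rw [autB_evalFrom_ab]
      split_ifs <;> omega
    · intro j
      rw [DFA.evalFrom_of_append, DFA.evalFrom_cons, DFA.evalFrom_cons, DFA.evalFrom_nil,
        autC_step_a, autC_step_b, ← succ_mod_eq_ite (Fin.isLt _), h2, Nat.mod_add_mod,
        Nat.add_assoc]

/-- The loop words act transitively on the pairs of a state of `autB` and a state of `autC`: the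
row can be prescribed by passing through row `1`, where powers of `ab` adjust the column. -/
theorem exists_isLoopWord_evalFrom (hn : 3 ≤ n) (hp : 2 ≤ p) (i i' : Fin n) (j j' : Fin p) :
    ∃ w, IsLoopWord w ∧ (autB n (two_le_of_three_le hn)).evalFrom i w = i' ∧
      (autC p hp).evalFrom j w = j' := by
  obtain ⟨u, hu, hu1⟩ := exists_isLoopWord_autB_to_one hn i
  obtain ⟨v, hv, hv1⟩ := exists_isLoopWord_autB_of_one hn _ hu1 i'.2
  obtain ⟨c, hc⟩ := hv.exists_autC_evalFrom hp
  set r := ((autC p hp).evalFrom j u).val + c with hr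
  obtain ⟨w, hw, hw1, hw2⟩ := exists_isLoopWord_shift hn hp _ hu1 (j'.val + (p - r % p))
  refine ⟨u ++ (w ++ v), hu.append (hw.append hv), ?_, ?_⟩
  · rw [DFA.evalFrom_of_append, DFA.evalFrom_of_append, hw1]
    exact Fin.ext hv1
  · ext
    rw [DFA.evalFrom_of_append, DFA.evalFrom_of_append, hc, hw2, Nat.mod_add_mod]
    have h1 : r % p < p := Nat.mod_lt _ (by omega)
    have h2 := Nat.mod_add_div r p
    have : ((autC p hp).evalFrom j u).val + (j'.val + (p - r % p)) + c =
        j'.val + p * (1 + r / p) := by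
      rw [mul_add]
      omega
    rw [this, Nat.add_mul_mod_self_left, Nat.mod_eq_of_lt j'.2]

end loops

/-! ### Subset automata over the first witness -/

section subset

variable {m : ℕ} {X : Type} [DecidableEq X] {δ : X → Letter → X} {I F : Finset X}

/-- No initial points are added while a loop word is read from the state `0`. -/
theorem concatDFA_evalFrom_isLoopWord (hm : 3 ≤ m) {w : List Letter} (hw : IsLoopWord w)
    {q : Fin m} (hq : q.val = 0) (S : Finset X) :
    (concatDFA (autA m (two_le_of_three_le hm)) δ I F).evalFrom (q, S) w =
      (q, S.image fun x => w.foldl δ x) := by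
  have hacc : ∀ {r : Fin m}, r.val < 2 → r ∉ (autA m (two_le_of_three_le hm)).accept := by
    intro r hr
    rw [mem_autA_accept]
    omega
  induction hw generalizing S with
  | nil => simp
  | ab _ ih =>
    have h1 : ((autA m (two_le_of_three_le hm)).step q .a).val = 1 := by
      rw [autA_step_a]
      split_ifs <;> omega
    have h2 : ((autA m (two_le_of_three_le hm)).step
        ((autA m (two_le_of_three_le hm)).step q .a) .b).val = 0 := by
      rw [autA_step_b]
      split_ifs <;> omega
    rw [DFA.evalFrom_cons, DFA.evalFrom_cons,
      concatDFA_step_of_notMem _ _ _ _ (q := q) (l := .a) (hacc (by omega)),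
      concatDFA_step_of_notMem _ _ _ _ (l := .b) (hacc (by omega)), Fin.ext (h2.trans hq.symm), ih,
      image_image, image_image]
    rfl
  | bb _ ih =>
    have h1 : ((autA m (two_le_of_three_le hm)).step q .b).val = 1 := by
      rw [autA_step_b]
      split_ifs; omega
    have h2 : ((autA m (two_le_of_three_le hm)).step
        ((autA m (two_le_of_three_le hm)).step q .b) .b).val = 0 := by
      rw [autA_step_b]
      split_ifs <;> omega
    rw [DFA.evalFrom_cons, DFA.evalFrom_cons,
      concatDFA_step_of_notMem _ _ _ _ (q := q) (l := .b) (hacc (by omega)),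
      concatDFA_step_of_notMem _ _ _ _ (l := .b) (hacc (by omega)), Fin.ext (h2.trans hq.symm), ih,
      image_image, image_image]
    rfl

theorem exists_image_eq_of_bijective {f : X → X} (hf : Function.Bijective f) (S : Finset X) :
    ∃ T : Finset X, T.image f = S ∧ #T = #S :=
  ⟨S.image (Equiv.ofBijective f hf).symm, by
    rw [image_image]
    have : f ∘ (Equiv.ofBijective f hf).symm = id :=
      funext (Equiv.ofBijective f hf).apply_symm_apply
    rw [this, image_id],
    card_image_of_injective _ (Equiv.injective _)⟩

theorem subset_of_forall_mem_image {f : X → X} (hf : Function.Injective f) {S T : Finset X}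
    (h : ∀ x ∈ S, f x ∈ T.image f) : S ⊆ T := by
  intro x hx
  obtain ⟨y, hy, hxy⟩ := mem_image.1 (h x hx)
  rwa [← hf hxy]

/-- Reachability of the valid states, by induction on the size of the set. A nonempty set over the
state `0` is moved back by a loop word and the letter `a` to a set over the final state that
contains `I`; there points of `I` may be removed before going back one more step. -/
theorem exists_concatDFA_eval_eq (hm : 3 ≤ m) (ha : Function.Bijective (δ · .a))
    (hb : Function.Bijective (δ · .b)) {ok : Finset X → Prop}
    (hok : ∀ S l, ok (S.image (δ · l)) ↔ ok S)
    (hloop : ∀ S, ok S → S.Nonempty →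
      ∃ w, IsLoopWord w ∧ ∀ x ∈ I, w.foldl δ (δ x .a) ∈ S)
    (hremove : ∀ S, ok S → I ⊆ S → ∃ T ⊂ S, ok T ∧ T ∪ I = S)
    (S : Finset X) (q : Fin m) (hS : ok S) (hq : q.val = m - 1 → I ⊆ S) :
    ∃ w, (concatDFA (autA m (two_le_of_three_le hm)) δ I F).eval w = (q, S) := by
  set A := autA m (two_le_of_three_le hm) with hA
  set M := concatDFA A δ I F with hM
  have hokw : ∀ (w : List Letter) S, ok (S.image fun x => w.foldl δ x) ↔ ok S := by
    intro w
    induction w with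
    | nil => intro S; simp
    | cons l w ih =>
      intro S
      rw [← hok S l, ← ih (S.image (δ · l)), image_image]
      rfl
  have hacc : ∀ {r : Fin m}, r ∈ A.accept ↔ r.val = m - 1 := mem_autA_accept _
  have hstep : ∀ {r r' : Fin m} {T T' : Finset X}, (∃ w, M.eval w = (r, T)) →
      M.step (r, T) .a = (r', T') → ∃ w, M.eval w = (r', T') := by
    rintro r r' T T' ⟨w, hw⟩ h
    exact ⟨w ++ [.a], by rw [DFA.eval_append_singleton, hw, h]⟩
  induction hk : #S using Nat.strong_induction_on generalizing S q with
  | _ k ih =>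
  -- sets of this size over the final state
  have hlast : ∀ (T : Finset X) (r : Fin m), ok T → r.val = m - 1 → I ⊆ T → #T = k →
      ∃ w, M.eval w = (r, T) := by
    intro T r hT hr hIT hTk
    obtain ⟨U, hUT, hU, hUI⟩ := hremove T hT hIT
    obtain ⟨V, rfl, hVU⟩ := exists_image_eq_of_bijective ha U
    have hcard := card_lt_card hUT
    have h1 : (A.step ⟨m - 2, by omega⟩ .a).val = m - 1 := by
      rw [hA, autA_step_a]
      simp only
      split_ifs <;> omega
    refine hstep (ih #V (by omega) V ⟨m - 2, by omega⟩ ((hok _ _).1 hU) ?_ rfl) ?_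
    · intro h
      simp only at h
      omega
    · rw [hM, concatDFA_step_of_mem _ _ _ _ (hacc.2 h1), hUI, Fin.ext (h1.trans hr.symm)]
  -- sets of this size over the other states
  have hother : ∀ (d : ℕ) (T : Finset X) (r : Fin m), ok T → r.val = d → d < m - 1 → #T = k →
      ∃ w, M.eval w = (r, T) := by
    intro d
    induction d with
    | zero =>
      intro T r hT hr _ hTk
      rcases T.eq_empty_or_nonempty with rfl | hne
      · refine ⟨[], ?_⟩
        have h0 : A.start ∉ A.accept := by
          rw [hacc]
          have : A.start.val = 0 := rfl
          omega
        have h1 : r = A.start := Fin.ext hr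
        rw [h1]
        simp [hM, concatDFA, h0]
      · obtain ⟨w, hw, hIw⟩ := hloop T hT hne
        obtain ⟨U, rfl, hU⟩ := exists_image_eq_of_bijective (hw.foldl_bijective ha hb) T
        obtain ⟨V, rfl, hV⟩ := exists_image_eq_of_bijective ha U
        have hVok : ok V := (hok _ _).1 ((hokw _ _).1 hT)
        have hIV : I ⊆ V := by
          refine subset_of_forall_mem_image ha.1 fun x hx => ?_
          obtain ⟨y, hy, hxy⟩ := mem_image.1 (hIw x hx)
          rwa [← (hw.foldl_bijective ha hb).1 hxy]
        obtain ⟨u, hu⟩ := hlast V ⟨m - 1, by omega⟩ hVok rfl hIV (by omega)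
        have h1 : (A.step ⟨m - 1, by omega⟩ .a).val = 0 := by
          rw [hA, autA_step_a]
          simp only
          split_ifs <;> omega
        refine ⟨u ++ .a :: w, ?_⟩
        rw [DFA.eval, DFA.evalFrom_of_append]
        rw [DFA.eval] at hu
        rw [hu, DFA.evalFrom_cons, hM, concatDFA_step_of_notMem _ _ _ _ (by rw [hacc]; omega),
          concatDFA_evalFrom_isLoopWord hm hw h1, Fin.ext (h1.trans hr.symm)]
    | succ d ihd =>
      intro T r hT hr hd hTk
      obtain ⟨U, rfl, hU⟩ := exists_image_eq_of_bijective ha T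
      have h1 : (A.step ⟨d, by omega⟩ .a).val = d + 1 := by
        rw [hA, autA_step_a]
        simp only
        split_ifs <;> omega
      refine hstep (ihd U ⟨d, by omega⟩ ((hok _ _).1 hT) rfl (by omega) (by omega)) ?_
      rw [hM, concatDFA_step_of_notMem _ _ _ _ (by rw [hacc]; omega), Fin.ext (h1.trans hr.symm)]
  by_cases h : q.val = m - 1
  · exact hlast S q hS h (hq h) hk
  · exact hother q.val S q hS rfl (by omega) hk

end subset

/-! ### Distinguishing states with different sets -/

section distinguish

variable {m : ℕ} {X : Type} [DecidableEq X] {δ : X → Letter → X} {I F : Finset X}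

/-- The states `s` and `t` are equivalent, although the point `x` belongs to the set of `s` and not
to the set of `t`. For the witnesses this is impossible. -/
def EquivalentDespite {Q : Type} (M : DFA Letter (Q × Finset X)) (s t : Q × Finset X) (x : X) :
    Prop :=
  M.acceptsFrom s = M.acceptsFrom t ∧ x ∈ s.2 ∧ x ∉ t.2

/-- A difference between equivalent states is carried along by every letter that maps no other point
to the same image, unless that image is added to both sets. -/
theorem EquivalentDespite.step {Q : Type} {A : DFA Letter Q} {s t : Q × Finset X} {x : X}
    (h : EquivalentDespite (concatDFA A δ I F) s t x) (l : Letter)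
    (hx : ∀ y, δ y l = δ x l → y = x) (hI : A.step t.1 l ∈ A.accept → δ x l ∉ I) :
    EquivalentDespite (concatDFA A δ I F) ((concatDFA A δ I F).step s l)
      ((concatDFA A δ I F).step t l) (δ x l) := by
  refine ⟨DFA.acceptsFrom_step_congr _ h.1 l, ?_, ?_⟩
  · exact (mem_concatDFA_step ..).2 (Or.inl ⟨x, h.2.1, rfl⟩)
  · rw [mem_concatDFA_step]
    rintro (⟨y, hy, hyx⟩ | ⟨h1, h2⟩)
    · rw [hx y hyx] at hy
      exact h.2.2 hy
    · exact hI h1 h2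

/-- A difference at a point outside `I` that is fixed by the letter `a` persists while powers of `a`
lead to the state `0` of `autA`. -/
theorem EquivalentDespite.exists_fst_eq_zero (hm : 2 ≤ m) {s t : Fin m × Finset X} {x : X}
    (h : EquivalentDespite (concatDFA (autA m hm) δ I F) s t x) (hx : δ x .a = x)
    (hx' : ∀ y, δ y .a = x → y = x) (hI : x ∉ I) :
    ∃ s' t', EquivalentDespite (concatDFA (autA m hm) δ I F) s' t' x ∧ t'.1.val = 0 := by
  induction hd : m - t.1.val using Nat.strong_induction_on generalizing s t with
  | _ d ih =>
  have h1 := h.step .a (by rwa [hx]) (by rw [hx]; exact fun _ => hI)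
  rw [hx] at h1
  have h2 := autA_step_a hm t.1
  rw [← concatDFA_step_fst (autA m hm) δ I F] at h2
  have h3 := t.1.2
  split_ifs at h2 with h4
  · exact ⟨_, _, h1, h2⟩
  · exact ih _ (by omega) h1 rfl

theorem concatDFA_step_c (hm : 2 ≤ m) (hc : ∀ x ∈ I, δ x .c = x) {q : Fin m} {S : Finset X}
    (hq : q.val = m - 1 → I ⊆ S) :
    (concatDFA (autA m hm) δ I F).step (q, S) .c = (q, S.image (δ · .c)) := by
  by_cases h : (autA m hm).step q .c ∈ (autA m hm).accept
  · rw [concatDFA_step_of_mem _ _ _ _ h, autA_step_c, union_eq_left.2]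
    intro x hx
    rw [autA_step_c, mem_autA_accept] at h
    exact mem_image.2 ⟨x, hq h hx, hc x hx⟩
  · rw [concatDFA_step_of_notMem _ _ _ _ h, autA_step_c]

/-- If no difference between the sets of equivalent states is possible, then all valid states are
pairwise distinguishable. For states with equal sets, powers of `ca` produce a difference: once just
one of the two states becomes final, the point `x₀` of `I`, which is not in the range of `ca`, is
added to one set only. -/
theorem injOn_acceptsFrom_validStates [Fintype X] (hm : 2 ≤ m) (hc : ∀ x ∈ I, δ x .c = x) {x₀ : X}
    (hx₀ : x₀ ∈ I) (hx₀' : ∀ y, δ (δ y .c) .a ≠ x₀)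
    (hset : ∀ s t x, ¬EquivalentDespite (concatDFA (autA m hm) δ I F) s t x)
    (ok : Finset X → Prop) {f : Fin m} (hf : f.val = m - 1) :
    Set.InjOn (concatDFA (autA m hm) δ I F).acceptsFrom (validStates I ok f) := by
  set A := autA m hm with hA
  set M := concatDFA A δ I F with hM
  have key : ∀ (d : ℕ) (q q' : Fin m) (S : Finset X), m - 1 - q.val = d → q.val < m - 1 →
      q ≠ q' → (q'.val = m - 1 → I ⊆ S) → M.acceptsFrom (q, S) ≠ M.acceptsFrom (q', S) := by
    intro d
    induction d with
    | zero => intro q q' S hd hq; omega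
    | succ d ih =>
      intro q q' S hd hq hne hq' h
      have h1 := M.acceptsFrom_step_congr h .c
      rw [hM, concatDFA_step_c hm hc hq', concatDFA_step_c hm hc (fun e => by omega)] at h1
      have h2 := M.acceptsFrom_step_congr h1 .a
      have hx : ∀ r : Fin m, x₀ ∈ (M.step (r, S.image (δ · .c)) .a).2 ↔ A.step r .a ∈ A.accept := by
        intro r
        rw [hM, mem_concatDFA_step]
        constructor
        · rintro (⟨y, hy, hyx⟩ | h)
          · obtain ⟨z, _, rfl⟩ := mem_image.1 hy
            exact absurd hyx (hx₀' z)
          · exact h.1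
        · exact fun h => Or.inr ⟨h, hx₀⟩
      have hne' : A.step q .a ≠ A.step q' .a := fun e => hne (autA_step_a_injective hm e)
      have hacc : ∀ r, r ∈ A.accept ↔ r.val = m - 1 := fun r => mem_autA_accept hm
      by_cases hqa : A.step q .a ∈ A.accept
      · refine hset _ _ x₀ ⟨h2, (hx q).2 hqa, fun h => hne' ?_⟩
        have h3 := (hx q').1 h
        rw [hacc] at h3 hqa
        exact Fin.ext (hqa.trans h3.symm)
      · by_cases hqa' : A.step q' .a ∈ A.accept
        · exact hset _ _ x₀ ⟨h2.symm, (hx q').2 hqa', fun h => hqa ((hx q).1 h)⟩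
        · rw [hM, concatDFA_step_of_notMem _ _ _ _ hqa, concatDFA_step_of_notMem _ _ _ _ hqa'] at h2
          rw [hacc] at hqa hqa'
          have h3 : (A.step q .a).val = q.val + 1 := by
            rw [hA, autA_step_a, if_neg (by omega)]
          exact ih _ _ _ (by omega) (by omega) hne' (fun e => absurd e hqa') h2
  rintro ⟨q, S⟩ hs ⟨q', S'⟩ hs' h
  rw [mem_coe, mem_validStates] at hs hs'
  have hSS : S = S' := by
    ext x
    by_contra hx
    rcases not_iff.1 hx with hx
    by_cases hxS : x ∈ S
    · exact hset _ _ x ⟨h, hxS, fun hx' => (hx.2 hx') hxS⟩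
    · exact hset _ _ x ⟨h.symm, hx.1 hxS, hxS⟩
  subst hSS
  by_contra hne
  have hqq : q ≠ q' := fun e => hne (by rw [e])
  by_cases hq : q.val < m - 1
  · exact key _ q q' S rfl hq hqq (fun e => hs'.2 (Fin.ext (e.trans hf.symm))) h
  · have : q'.val < m - 1 := by
      have : q.val ≠ q'.val := fun e => hqq (Fin.ext e)
      omega
    exact key _ q' q S rfl this hqq.symm (fun e => hs.2 (Fin.ext (e.trans hf.symm))) h.symm

/-- A difference over the state `0` is refuted by a loop word that leads it, but no point of the
other set, to a final point. -/
theorem EquivalentDespite.exists_mem_final (hm : 3 ≤ m) {s t : Fin m × Finset X} {x : X}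
    (h : EquivalentDespite (concatDFA (autA m (two_le_of_three_le hm)) δ I F) s t x)
    (ht : t.1.val = 0) {w : List Letter} (hw : IsLoopWord w) (hx : w.foldl δ x ∈ F) :
    ∃ y ∈ t.2, w.foldl δ y ∈ F := by
  have h1 : w ∈ (concatDFA (autA m (two_le_of_three_le hm)) δ I F).acceptsFrom s :=
    ⟨_, mem_concatDFA_evalFrom _ _ _ _ h.2.1, hx⟩
  rw [h.1] at h1
  obtain ⟨z, hz, hzF⟩ := h1
  obtain ⟨q, S⟩ := t
  rw [concatDFA_evalFrom_isLoopWord hm hw ht] at hz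
  obtain ⟨y, hy, rfl⟩ := mem_image.1 hz
  exact ⟨y, hy, hzF⟩

end distinguish

/-! ### Optimality of the witnesses -/

section optimality

variable {m n p : ℕ}

theorem prodAction_bijective {α P R : Type} {B : DFA α P} {C : DFA α R} {l : α}
    (hB : Function.Bijective (B.step · l)) (hC : Function.Bijective (C.step · l)) :
    Function.Bijective (prodAction B C · l) :=
  hB.prodMap hC

theorem sumAction_bijective {α P R : Type} {B : DFA α P} {C : DFA α R} {l : α}
    (hB : Function.Bijective (B.step · l)) (hC : Function.Bijective (C.step · l)) :
    Function.Bijective (sumAction B C · l) :=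
  ⟨hB.1.sumMap hC.1, hB.2.sumMap hC.2⟩

/-- Letters `b` move a difference out of the rows `0` and `1` without entering `I`, and in
the other rows it can be kept until the second state is over `0`, where a loop word applies. -/
theorem not_equivalentDespite_interDFA (hm : 3 ≤ m) (hn : 3 ≤ n) (hp : 3 ≤ p)
    (s t : Fin m × Finset (Fin n × Fin p)) (x : Fin n × Fin p) :
    ¬EquivalentDespite (interDFA (autA m (two_le_of_three_le hm))
      (autB n (two_le_of_three_le hn)) (autC p (two_le_of_three_le hp))) s t x := by
  set B := autB n (two_le_of_three_le hn) with hB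
  set C := autC p (two_le_of_three_le hp) with hC
  have ha : Function.Bijective (prodAction B C · .a) :=
    prodAction_bijective (autB_step_a_bijective _) (autC_step_a_bijective _)
  have hb : Function.Bijective (prodAction B C · .b) :=
    prodAction_bijective (autB_step_b_bijective _) (autC_step_b_bijective _)
  have hI : ∀ y : Fin n × Fin p, y.1.val ≠ 0 → y ∉ ({(B.start, C.start)} : Finset _) := by
    intro y hy h
    rw [mem_singleton] at h
    exact hy (by rw [h]; rfl)
  have h2 : ∀ s t x, 2 ≤ x.1.val →
      ¬EquivalentDespite (interDFA (autA m (two_le_of_three_le hm)) B C) s t x := by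
    intro s t x hx h
    have hxa : prodAction B C x .a = x := by
      refine Prod.ext (Fin.ext ?_) (autC_step_a (show 2 ≤ p by omega) x.2)
      rw [prodAction, hB, autB_step_a, if_neg (by omega), if_neg (by omega)]
    obtain ⟨s', t', h', ht'⟩ := h.exists_fst_eq_zero _ hxa
      (fun y hy => ha.1 (hy.trans hxa.symm)) (hI x (by omega))
    obtain ⟨w, hw, hw1, hw2⟩ := exists_isLoopWord_evalFrom hn (show 2 ≤ p by omega) x.1
      ⟨n - 1, by omega⟩ x.2 ⟨p - 1, by omega⟩
    have hwx : w.foldl (prodAction B C) x = (⟨n - 1, by omega⟩, ⟨p - 1, by omega⟩) := by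
      rw [foldl_prodAction, hw1, hw2]
    have hF : ∀ y, y ∈ prodFinal B C ↔ y = (⟨n - 1, by omega⟩, ⟨p - 1, by omega⟩) := by
      intro y
      rw [mem_prodFinal, mem_autB_accept, mem_autC_accept, Prod.ext_iff, Fin.ext_iff, Fin.ext_iff]
    obtain ⟨y, hy, hyF⟩ := h'.exists_mem_final hm ht' hw ((hF _).2 hwx)
    rw [hF, ← hwx] at hyF
    exact h'.2.2 ((hw.foldl_bijective ha hb).1 hyF ▸ hy)
  have hstep : ∀ x : Fin n × Fin p, x.1.val < 2 →
      (prodAction B C x .b).1.val = x.1.val + 1 := by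
    intro x hx
    rw [prodAction, hB, autB_step_b, if_neg (by omega)]
  have h1 : ∀ s t x, 1 ≤ x.1.val →
      ¬EquivalentDespite (interDFA (autA m (two_le_of_three_le hm)) B C) s t x := by
    intro s t x hx h
    rcases Nat.lt_or_ge x.1.val 2 with h3 | h3
    · have h4 := hstep x h3
      exact h2 _ _ _ (by omega) (h.step .b (fun y hy => hb.1 hy) fun _ => hI _ (by omega))
    · exact h2 s t x h3 h
  intro h
  rcases Nat.lt_or_ge x.1.val 1 with h3 | h3
  · have h4 := hstep x (by omega)
    exact h1 _ _ _ (by omega) (h.step .b (fun y hy => hb.1 hy) fun _ => hI _ (by omega))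
  · exact h1 s t x h3 h

theorem stateComplexity_catInter_witness (hm : 3 ≤ m) (hn : 3 ≤ n) (hp : 3 ≤ p) :
    stateComplexity (catInter (witnessA m (two_le_of_three_le hm))
      (witnessB n (two_le_of_three_le hn))
      (witnessC p (two_le_of_three_le hp))) = (m - 1) * 2 ^ (n * p) + 2 ^ (n * p - 1) := by
  set A := autA m (two_le_of_three_le hm)
  set B := autB n (two_le_of_three_le hn)
  set C := autC p (two_le_of_three_le hp)
  have hf : (⟨m - 1, by omega⟩ : Fin m) ∈ A.accept := (mem_autA_accept _).2 rfl
  have h : catInter (witnessA m (two_le_of_three_le hm)) (witnessB n (two_le_of_three_le hn))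
      (witnessC p (two_le_of_three_le hp)) =
      (interDFA A B C).accepts := (interDFA_accepts A B C).symm
  rw [h, ← card_interStates B C ⟨m - 1, by omega⟩]
  refine stateComplexity_accepts_eq _ _ (start_mem_interStates A B C hf)
    (step_mem_interStates A B C hf) ?_ ?_
  · rintro ⟨q, S⟩ hs
    rw [interStates, mem_validStates] at hs
    refine exists_concatDFA_eval_eq hm
      (prodAction_bijective (autB_step_a_bijective _) (autC_step_a_bijective _))
      (prodAction_bijective (autB_step_b_bijective _) (autC_step_b_bijective _))
      (ok := fun _ => True) (fun _ _ => Iff.rfl) ?_ ?_ S q trivial (fun e => hs.2 (Fin.ext e))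
    · rintro S - ⟨x, hx⟩
      obtain ⟨w, hw, hw1, hw2⟩ := exists_isLoopWord_evalFrom hn (show 2 ≤ p by omega)
        (B.step B.start .a) x.1 (C.step C.start .a) x.2
      refine ⟨w, hw, fun y hy => ?_⟩
      rw [mem_singleton] at hy
      rw [hy, foldl_prodAction]
      have e : (B.evalFrom (B.step B.start .a) w, C.evalFrom (C.step C.start .a) w) = x :=
        Prod.ext hw1 hw2
      exact e ▸ hx
    · intro S _ hS
      exact ⟨S.erase _, erase_ssubset (hS (mem_singleton_self _)), trivial, by
        rw [union_comm, ← insert_eq, insert_erase (hS (mem_singleton_self _))]⟩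
  · refine injOn_acceptsFrom_validStates _ ?_ (mem_singleton_self _) ?_
      (not_equivalentDespite_interDFA hm hn hp) _ rfl
    · intro y hy
      rw [mem_singleton] at hy
      rw [hy]
      refine Prod.ext (Fin.ext ?_) (Fin.ext ?_)
      · rw [prodAction, autB_step_c, if_neg]
        exact zero_ne_one
      · rw [prodAction, autC_step_c, if_neg]
        exact zero_ne_one
    · intro y hy
      have h1 := congrArg (fun y => (Prod.fst y).val) hy
      simp only [prodAction] at h1
      rw [autB_step_a, autB_step_c, autB_start_val] at h1
      split_ifs at h1 <;> omega

/-- The index of a point of the disjoint union of the states of `autB` and `autC`. -/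
def sumVal (x : Fin n ⊕ Fin p) : ℕ :=
  x.elim Fin.val Fin.val

theorem sumAction_of_two_le (hn : 2 ≤ n) (hp : 2 ≤ p) {x : Fin n ⊕ Fin p} (hx : 2 ≤ sumVal x) :
    sumAction (autB n hn) (autC p hp) x .a = x ∧ sumAction (autB n hn) (autC p hp) x .c = x := by
  rcases x with i | j
  · have hi : 2 ≤ i.val := hx
    refine ⟨congrArg Sum.inl (Fin.ext ?_), congrArg Sum.inl (Fin.ext ?_)⟩
    · rw [autB_step_a, if_neg (by omega), if_neg (by omega)]
    · rw [autB_step_c, if_neg (by omega)]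
  · have hj : 2 ≤ j.val := hx
    refine ⟨congrArg Sum.inr (autC_step_a _ _), congrArg Sum.inr (Fin.ext ?_)⟩
    rw [autC_step_c, if_neg (by omega)]

theorem sumVal_sumAction_c (hn : 2 ≤ n) (hp : 2 ≤ p) (x : Fin n ⊕ Fin p) :
    sumVal (sumAction (autB n hn) (autC p hp) x .c) = if sumVal x = 1 then 0 else sumVal x := by
  rcases x with i | j
  · exact autB_step_c hn i
  · exact autC_step_c hp j

theorem sumVal_sumAction_b (hn : 3 ≤ n) (hp : 3 ≤ p) {x : Fin n ⊕ Fin p} (hx : sumVal x < 2) :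
    sumVal (sumAction (autB n (two_le_of_three_le hn)) (autC p (two_le_of_three_le hp)) x .b) =
      sumVal x + 1 := by
  rcases x with i | j
  · have hi : i.val < 2 := hx
    refine (autB_step_b _ i).trans ?_
    rw [if_neg (by omega)]
    rfl
  · have hj : j.val < 2 := hx
    refine (autC_step_b _ j).trans ?_
    rw [if_neg (by omega)]
    rfl

theorem notMem_sumInitial (hn : 2 ≤ n) (hp : 2 ≤ p) {x : Fin n ⊕ Fin p} (hx : sumVal x ≠ 0) :
    x ∉ ({Sum.inl (autB n hn).start, Sum.inr (autC p hp).start} : Finset (Fin n ⊕ Fin p)) := by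
  intro h
  rw [mem_insert, mem_singleton] at h
  rcases h with rfl | rfl <;> exact hx rfl

/-- Suppose that the first set contains one of the points `inl i` and `inr j`, the second set none
of them. A loop word leads both points to final points, which distinguishes the states. -/
theorem not_equivalentDespite_unionDFA_of_fst_eq_zero (hm : 3 ≤ m) (hn : 3 ≤ n) (hp : 3 ≤ p)
    {s t : Fin m × Finset (Fin n ⊕ Fin p)} {x : Fin n ⊕ Fin p} (ht : t.1.val = 0) {i : Fin n}
    {j : Fin p} (hi : Sum.inl i ∉ t.2) (hj : Sum.inr j ∉ t.2) (hx : x = Sum.inl i ∨ x = Sum.inr j) :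
    ¬EquivalentDespite (unionDFA (autA m (two_le_of_three_le hm))
      (autB n (two_le_of_three_le hn)) (autC p (two_le_of_three_le hp))) s t x := by
  intro h
  obtain ⟨w, hw, hw1, hw2⟩ := exists_isLoopWord_evalFrom hn (show 2 ≤ p by omega) i
    ⟨n - 1, by omega⟩ j ⟨p - 1, by omega⟩
  have hinj := (hw.foldl_bijective
    (sumAction_bijective (autB_step_a_bijective (show 2 ≤ n by omega))
      (autC_step_a_bijective (show 2 ≤ p by omega)))
    (sumAction_bijective (autB_step_b_bijective _) (autC_step_b_bijective _))).1
  have hF : ∀ {y},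
      w.foldl (sumAction (autB n (two_le_of_three_le hn)) (autC p (two_le_of_three_le hp))) y ∈
      sumFinal (autB n (two_le_of_three_le hn)) (autC p (two_le_of_three_le hp)) ↔
        y = Sum.inl i ∨ y = Sum.inr j := by
    intro y
    rcases y with k | k
    · rw [foldl_sumAction_inl, inl_mem_sumFinal, mem_autB_accept]
      constructor
      · intro hk
        left
        refine hinj ?_
        simp only
        rw [foldl_sumAction_inl, foldl_sumAction_inl, hw1]
        exact congrArg Sum.inl (Fin.ext hk)
      · rintro (e | e)
        · rw [Sum.inl.inj e, hw1]
        · cases e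
    · rw [foldl_sumAction_inr, inr_mem_sumFinal, mem_autC_accept]
      constructor
      · intro hk
        right
        refine hinj ?_
        simp only
        rw [foldl_sumAction_inr, foldl_sumAction_inr, hw2]
        exact congrArg Sum.inr (Fin.ext hk)
      · rintro (e | e)
        · cases e
        · rw [Sum.inr.inj e, hw2]
  obtain ⟨y, hy, hyF⟩ := h.exists_mem_final hm ht hw (hF.2 hx)
  rcases hF.1 hyF with rfl | rfl
  · exact hi hy
  · exact hj hy

/-- Differences between the sets can be moved to a point that is fixed by `a` and `c`. After reading
`c`, no set contains the points with index `1`, so that a loop word can be chosen that makes only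
the difference final. -/
theorem not_equivalentDespite_unionDFA (hm : 3 ≤ m) (hn : 3 ≤ n) (hp : 3 ≤ p)
    (s t : Fin m × Finset (Fin n ⊕ Fin p)) (x : Fin n ⊕ Fin p) :
    ¬EquivalentDespite (unionDFA (autA m (two_le_of_three_le hm))
      (autB n (two_le_of_three_le hn)) (autC p (two_le_of_three_le hp))) s t x := by
  have hn2 : 2 ≤ n := by omega
  have hp2 : 2 ≤ p := by omega
  have ha : Function.Bijective (sumAction (autB n hn2) (autC p hp2) · .a) :=
    sumAction_bijective (autB_step_a_bijective _) (autC_step_a_bijective _)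
  have hb : Function.Bijective (sumAction (autB n hn2) (autC p hp2) · .b) :=
    sumAction_bijective (autB_step_b_bijective _) (autC_step_b_bijective _)
  have h2 : ∀ s t x, 2 ≤ sumVal x →
      ¬EquivalentDespite (unionDFA (autA m (two_le_of_three_le hm)) (autB n hn2) (autC p hp2))
        s t x := by
    intro s t x hx h
    obtain ⟨hxa, hxc⟩ := sumAction_of_two_le hn2 hp2 hx
    obtain ⟨s', t', h', ht'⟩ := h.exists_fst_eq_zero _ hxa
      (fun y hy => ha.1 (hy.trans hxa.symm)) (notMem_sumInitial _ _ (by omega))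
    have hc := h'.step .c (by
      intro y hy
      have h3 := congrArg sumVal hy
      rw [sumVal_sumAction_c, hxc] at h3
      have h4 : 2 ≤ sumVal y := by
        split_ifs at h3 <;> omega
      rw [hxc, (sumAction_of_two_le hn2 hp2 h4).2] at hy
      exact hy) (by rw [hxc]; exact fun _ => notMem_sumInitial _ _ (by omega))
    rw [hxc] at hc
    set t'' :=
      (unionDFA (autA m (two_le_of_three_le hm)) (autB n hn2) (autC p hp2)).step t' .c with ht''
    have h0 : t''.1.val = 0 := by
      rw [ht'', unionDFA, concatDFA_step_fst, autA_step_c, ht']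
    have h1 : ∀ y, sumVal y = 1 → y ∉ t''.2 := by
      intro y hy
      rw [ht'', unionDFA, mem_concatDFA_step]
      rintro (⟨z, -, rfl⟩ | ⟨-, h5⟩)
      · rw [sumVal_sumAction_c] at hy
        split_ifs at hy; omega
      · exact notMem_sumInitial _ _ (by omega) h5
    rcases x with i | j
    · exact not_equivalentDespite_unionDFA_of_fst_eq_zero hm hn hp h0 hc.2.2
        (h1 (Sum.inr ⟨1, by omega⟩) rfl) (Or.inl rfl) hc
    · exact not_equivalentDespite_unionDFA_of_fst_eq_zero hm hn hp h0
        (h1 (Sum.inl ⟨1, by omega⟩) rfl) hc.2.2 (Or.inr rfl) hc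
  have h1 : ∀ s t x, 1 ≤ sumVal x →
      ¬EquivalentDespite (unionDFA (autA m (two_le_of_three_le hm)) (autB n hn2) (autC p hp2))
        s t x := by
    intro s t x hx h
    rcases Nat.lt_or_ge (sumVal x) 2 with h3 | h3
    · have h4 := sumVal_sumAction_b hn hp h3
      exact h2 _ _ _ (by omega)
        (h.step .b (fun y hy => hb.1 hy) fun _ => notMem_sumInitial _ _ (by omega))
    · exact h2 s t x h3 h
  intro h
  rcases Nat.lt_or_ge (sumVal x) 1 with h3 | h3
  · have h4 := sumVal_sumAction_b hn hp (show sumVal x < 2 by omega)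
    exact h1 _ _ _ (by omega)
      (h.step .b (fun y hy => hb.1 hy) fun _ => notMem_sumInitial _ _ (by omega))
  · exact h1 s t x h3 h

/-- A set that contains both initial points arises from a smaller balanced set by adding them:
remove one of them if its part has another element, and otherwise take the empty set. -/
theorem SidesBalanced.exists_ssubset_union_eq {P R : Type} [DecidableEq P] [DecidableEq R]
    {S : Finset (P ⊕ R)} {i : P} {j : R} (hS : {Sum.inl i, Sum.inr j} ⊆ S) :
    ∃ T ⊂ S, SidesBalanced T ∧ T ∪ {Sum.inl i, Sum.inr j} = S := by
  have hi : Sum.inl i ∈ S := hS (by simp)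
  have hj : Sum.inr j ∈ S := hS (by simp)
  by_cases h1 : ∃ k, k ≠ i ∧ Sum.inl k ∈ S
  · obtain ⟨k, hki, hk⟩ := h1
    refine ⟨S.erase (Sum.inl i), erase_ssubset hi, SidesBalanced.of_mem (i := k) (j := j)
      (by simp [hki, hk]) (by simp [hj]), ?_⟩
    ext y
    simp only [mem_union, mem_erase, mem_insert, mem_singleton]
    by_cases hy : y = Sum.inl i
    · simp [hy, hi]
    · by_cases hy' : y = Sum.inr j <;> simp [hy, hy', hj]
  · by_cases h2 : ∃ k, k ≠ j ∧ Sum.inr k ∈ S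
    · obtain ⟨k, hkj, hk⟩ := h2
      refine ⟨S.erase (Sum.inr j), erase_ssubset hj, SidesBalanced.of_mem (i := i) (j := k)
        (by simp [hi]) (by simp [hkj, hk]), ?_⟩
      ext y
      simp only [mem_union, mem_erase, mem_insert, mem_singleton]
      by_cases hy : y = Sum.inl i
      · simp [hy, hi]
      · by_cases hy' : y = Sum.inr j <;> simp [hy', hj, hy]
    · push Not at h1 h2
      refine ⟨∅, Finset.empty_ssubset.2 ⟨_, hi⟩, sidesBalanced_empty, ?_⟩
      rw [empty_union]
      refine hS.antisymm ?_
      rintro (k | k) hk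
      · have : k = i := by
          by_contra hne
          exact h1 k hne hk
        simp [this]
      · have : k = j := by
          by_contra hne
          exact h2 k hne hk
        simp [this]

theorem stateComplexity_catUnion_witness (hm : 3 ≤ m) (hn : 3 ≤ n) (hp : 3 ≤ p) :
    stateComplexity (catUnion (witnessA m (two_le_of_three_le hm))
      (witnessB n (two_le_of_three_le hn))
      (witnessC p (two_le_of_three_le hp))) =
      (m - 1) * (2 ^ (n + p) - 2 ^ n - 2 ^ p + 2) + 2 ^ (n + p - 2) := by
  set A := autA m (two_le_of_three_le hm)
  set B := autB n (two_le_of_three_le hn)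
  set C := autC p (two_le_of_three_le hp)
  have hf : (⟨m - 1, by omega⟩ : Fin m) ∈ A.accept := (mem_autA_accept _).2 rfl
  have h : catUnion (witnessA m (two_le_of_three_le hm)) (witnessB n (two_le_of_three_le hn))
      (witnessC p (two_le_of_three_le hp)) =
      (unionDFA A B C).accepts := (unionDFA_accepts A B C).symm
  rw [h, ← card_unionStates B C ⟨m - 1, by omega⟩]
  refine stateComplexity_accepts_eq _ _ (start_mem_unionStates A B C hf)
    (step_mem_unionStates A B C hf) ?_ ?_
  · rintro ⟨q, S⟩ hs
    rw [unionStates, mem_validStates] at hs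
    refine exists_concatDFA_eval_eq hm
      (sumAction_bijective (autB_step_a_bijective _) (autC_step_a_bijective _))
      (sumAction_bijective (autB_step_b_bijective _) (autC_step_b_bijective _))
      (sidesBalanced_image_sumAction B C) ?_ (fun S _ => SidesBalanced.exists_ssubset_union_eq) S q
      hs.1 (fun e => hs.2 (Fin.ext e))
    intro S hS hne
    obtain ⟨i, j, hi, hj⟩ : ∃ i j, Sum.inl i ∈ S ∧ Sum.inr j ∈ S := by
      obtain ⟨i | j, hx⟩ := hne
      · obtain ⟨j, hj⟩ := hS.1 ⟨i, hx⟩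
        exact ⟨i, j, hx, hj⟩
      · obtain ⟨i, hi⟩ := hS.2 ⟨j, hx⟩
        exact ⟨i, j, hi, hx⟩
    obtain ⟨w, hw, hw1, hw2⟩ := exists_isLoopWord_evalFrom hn (show 2 ≤ p by omega)
      (B.step B.start .a) i (C.step C.start .a) j
    refine ⟨w, hw, fun y hy => ?_⟩
    rw [mem_insert, mem_singleton] at hy
    rcases hy with rfl | rfl
    · rw [sumAction, Sum.map_inl, foldl_sumAction_inl]
      convert hi
    · rw [sumAction, Sum.map_inr, foldl_sumAction_inr]
      convert hj
  · refine injOn_acceptsFrom_validStates _ ?_ (mem_insert_self _ _) ?_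
      (not_equivalentDespite_unionDFA hm hn hp) _ rfl
    · intro y hy
      rw [mem_insert, mem_singleton] at hy
      rcases hy with rfl | rfl
      · refine congrArg Sum.inl (Fin.ext ?_)
        rw [autB_step_c, if_neg]
        exact zero_ne_one
      · refine congrArg Sum.inr (Fin.ext ?_)
        rw [autC_step_c, if_neg]
        exact zero_ne_one
    · rintro (y | y) hy
      · have h1 := congrArg Fin.val (Sum.inl.inj hy)
        rw [autB_step_a, autB_step_c, autB_start_val] at h1
        split_ifs at h1 <;> omega
      · cases hy

end optimality

theorem mainTheorem2 (m n p : ℕ) (hm : 3 ≤ m) (hn : 3 ≤ n) (hp : 3 ≤ p) :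
    IsOperationStateComplexity catInter m n p ((m - 1) * 2 ^ (n * p) + 2 ^ (n * p - 1)) ∧
    IsOperationStateComplexity catUnion m n p
      ((m - 1) * (2 ^ (n + p) - 2 ^ n - 2 ^ p + 2) + 2 ^ (n + p - 2)) ∧
    witnessA m (by omega) ∈ languagesOfComplexity Letter m ∧
    witnessB n (by omega) ∈ languagesOfComplexity Letter n ∧
    witnessC p (by omega) ∈ languagesOfComplexity Letter p ∧
    stateComplexity
        (catInter (witnessA m (by omega)) (witnessB n (by omega)) (witnessC p (by omega))) =
      (m - 1) * 2 ^ (n * p) + 2 ^ (n * p - 1) ∧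
    stateComplexity
        (catUnion (witnessA m (by omega)) (witnessB n (by omega)) (witnessC p (by omega))) =
      (m - 1) * (2 ^ (n + p) - 2 ^ n - 2 ^ p + 2) + 2 ^ (n + p - 2) := by
  have hA : witnessA m (by omega) ∈ languagesOfComplexity Letter m :=
    brzozowski_mem_languagesOfComplexity _ _ _ _
  have hB : witnessB n (by omega) ∈ languagesOfComplexity Letter n :=
    brzozowski_mem_languagesOfComplexity _ _ _ _
  have hC : witnessC p (by omega) ∈ languagesOfComplexity Letter p :=
    brzozowski_mem_languagesOfComplexity _ _ _ _
  have hI := stateComplexity_catInter_witness hm hn hp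
  have hU := stateComplexity_catUnion_witness hm hn hp
  refine ⟨⟨⟨Letter, inferInstance, _, _, _, hA, hB, hC, hI⟩, ?_⟩,
    ⟨⟨Letter, inferInstance, _, _, _, hA, hB, hC, hU⟩, ?_⟩, hA, hB, hC, hI, hU⟩
  · rintro k ⟨α, _, L₁, L₂, L₃, h₁, h₂, h₃, rfl⟩
    exact stateComplexity_catInter_le (by omega) (by omega) (by omega) h₁.2 h₂.2 h₃.2
  · rintro k ⟨α, _, L₁, L₂, L₃, h₁, h₂, h₃, rfl⟩
    exact stateComplexity_catUnion_le (by omega) (by omega) (by omega) h₁.2 h₂.2 h₃.2
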